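/- Let $d_1,d_2\in\mathbb N$, $\beta\in\mathbb R$, $c>0$ and $2\le p<r$. Let $\mu^Y$ be a Borel probability measure on $\mathbb R^{d_2}$ with finite $r$-th moment, $\int|y|^r\,\mathrm d\mu^Y(y)<\infty$. Then there is a constant $C>0$, depending only on $\mu^Y,p,r$ and on the fixed parameters $d_1,d_2,\beta,c$, such that the following holds. Let $\mathcal E:\mathbb R^{d_1}\times\mathbb R^{d_2}\to\mathbb R$ be any cost function with $-c\le\mathcal E\le c$ for which there are $L>0$ and $s\ge 0$ such that $$|\mathcal E(z_0)-\mathcal E(z_1)|\le L\,(1+|z_0|+|z_1|)^s\,|z_0-z_1|\qquad\text{for all }z_0,z_1\in\mathbb R^{d_1+d_2}.$$ For a probability measure $\mu$ on $\mathbb R^{d_2}$ with finite first moment and $x\in\mathbb R^{d_1}$, let $$\mathbb Y_\beta(\mu,x):=\frac{\int y\,e^{\beta\mathcal E(x,y)}\,\mathrm d\mu(y)}{\int e^{\beta\mathcal E(x,y)}\,\mathrm d\mu(y)}$$ be the weighted mean. Let $Y^1,Y^2,\dots$ be i.i.d. random vectors with law $\mu^Y$ on any probability space, and let $\mu^{Y,N}=\frac1N\sum_{j=1}^N\delta_{Y^j}$.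 Then for all integers $N\ge 1$ $$\sup_{x\in\mathbb R^{d_1}}\mathbb E\,\bigl|\mathbb Y_\beta(\mu^{Y,N},x)-\mathbb Y_\beta(\mu^Y,x)\bigr|^p\le C\,N^{-p/2}.$$ -/

import Mathlib

open MeasureTheory ProbabilityTheory
open scoped ENNReal

namespace MinMaxCBO

/-- The set `𝒫_r(ℝᵈ)` of Borel probability measures on `ℝᵈ` with finite `r`-th moment
`∫ |y|^r dμ(y) < ∞`. -/
def finiteMomentMeasures (d : ℕ) (r : ℝ) : Set (Measure (EuclideanSpace ℝ (Fin d))) :=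
  {μ | IsProbabilityMeasure μ ∧ ∫⁻ y, ‖y‖ₑ ^ r ∂μ < ∞}

/-- Boundedness of the cost function: `-c ≤ ℰ(x, y) ≤ c` for all `x, y`. -/
def BoundedCost {d₁ d₂ : ℕ}
    (ℰ : EuclideanSpace ℝ (Fin d₁) → EuclideanSpace ℝ (Fin d₂) → ℝ) (c : ℝ) : Prop :=
  ∀ x y, -c ≤ ℰ x y ∧ ℰ x y ≤ c

/-- Lipschitz property with polynomial growth: there are `L > 0` and `s ≥ 0` with
`|ℰ(z₀) - ℰ(z₁)| ≤ L (1 + |z₀| + |z₁|)^s |z₀ - z₁|` for all `z₀ = (x₀, y₀)` and `z₁ = (x₁, y₁)`.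
Here `WithLp 2 (_ × _)` carries the Euclidean norm of `ℝ^(d₁ + d₂)`. -/
def PolyLipschitzCost {d₁ d₂ : ℕ}
    (ℰ : EuclideanSpace ℝ (Fin d₁) → EuclideanSpace ℝ (Fin d₂) → ℝ) : Prop :=
  ∃ L : ℝ, 0 < L ∧ ∃ s : ℝ, 0 ≤ s ∧
    ∀ z₀ z₁ : WithLp 2 (EuclideanSpace ℝ (Fin d₁) × EuclideanSpace ℝ (Fin d₂)),
      |ℰ z₀.fst z₀.snd - ℰ z₁.fst z₁.snd| ≤ L * (1 + ‖z₀‖ + ‖z₁‖) ^ s * ‖z₀ - z₁‖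

/-- The weight `ω_γ(x, y) = exp(-γ ℰ(x, y))`. -/
noncomputable def weight {d₁ d₂ : ℕ}
    (ℰ : EuclideanSpace ℝ (Fin d₁) → EuclideanSpace ℝ (Fin d₂) → ℝ) (γ : ℝ)
    (x : EuclideanSpace ℝ (Fin d₁)) (y : EuclideanSpace ℝ (Fin d₂)) : ℝ :=
  Real.exp (-γ * ℰ x y)

/-- The weighted mean `𝕐_β(μ, x) = (∫ y ω_{-β}(x, y) dμ(y)) / (∫ ω_{-β}(x, y) dμ(y))`. -/
noncomputable def consensusY {d₁ d₂ : ℕ}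
    (ℰ : EuclideanSpace ℝ (Fin d₁) → EuclideanSpace ℝ (Fin d₂) → ℝ) (β : ℝ)
    (μ : Measure (EuclideanSpace ℝ (Fin d₂))) (x : EuclideanSpace ℝ (Fin d₁)) :
    EuclideanSpace ℝ (Fin d₂) :=
  (∫ y, weight ℰ (-β) x y ∂μ)⁻¹ • ∫ y, weight ℰ (-β) x y • y ∂μ

/-- The empirical measure `(1/N) ∑_{j < N} δ_{v j}` of the first `N` terms of a sequence. -/
noncomputable def empiricalMeasure {d : ℕ} (N : ℕ) (v : ℕ → EuclideanSpace ℝ (Fin d)) :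
    Measure (EuclideanSpace ℝ (Fin d)) :=
  (N : ℝ≥0∞)⁻¹ • ∑ j ∈ Finset.range N, Measure.dirac (v j)

end MinMaxCBO

/-! Fix `x`, let `m` be the true weighted mean and `g y = ω(x, y) (y - m)`. The empirical mean minus
`m` is exactly `∑ g (Y j) / ∑ ω(x, Y j)`, and `∫ g ∂μ = 0` by the choice of `m`. As the cost is
bounded, the denominator is at least `N e^{-|β|c}` surely, so no fluctuation of the ratio has to be
controlled. It remains to show that the `p`-th moment of a sum of `N` i.i.d. centred vectors is of
order `N^{p/2}`; this is `exists_integral_norm_sum_rpow_le`. That inequality is proved by adding one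
summand at a time. `norm_add_rpow_le` expands `‖s + z‖ ^ p` to second order; independence and
centring remove the linear term, and the remainder fits in the increment of `n ↦ (K n)^{p/2}`. -/

/-! ### Second-order expansion of powers of the norm. -/

/-- A second-order upper bound for `(1 + t) ^ q` on `[-1, 3]`, for `q ≥ 1`. -/
lemma one_add_rpow_le_quadratic {q t : ℝ} (hq : 1 ≤ q) (h1 : -1 ≤ t) (h3 : t ≤ 3) :
    (1 + t) ^ q ≤ 1 + q * t + q ^ 2 * 4 ^ q * t ^ 2 := by
  have hu : 0 ≤ 1 + t := by linarith
  have h4 : (1 : ℝ) ≤ 4 ^ q := Real.one_le_rpow (by norm_num) (by linarith)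
  -- Convexity: the tangent to `u ^ q` at `u = 1 + t` lies below the graph at `u = 1`. This is
  -- Bernoulli at `(1 + t)⁻¹ - 1`, multiplied by `(1 + t) ^ q`.
  have tangent : (1 + t) ^ q ≤ 1 + q * t * (1 + t) ^ (q - 1) := by
    rcases hu.eq_or_lt with h0 | hpos
    · rw [← h0, Real.zero_rpow (by linarith)]
      obtain rfl : t = -1 := by linarith
      rcases hq.eq_or_lt with rfl | hq
      · simp
      · rw [Real.zero_rpow (by linarith)]; norm_num
    · have hB := one_add_mul_self_le_rpow_one_add
        (s := (1 + t)⁻¹ - 1) (by have := inv_pos.2 hpos; linarith) hq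
      rw [add_sub_cancel, Real.inv_rpow hu] at hB
      have hP : 0 < (1 + t) ^ q := Real.rpow_pos_of_pos hpos q
      have := mul_le_mul_of_nonneg_left hB hP.le
      rw [mul_inv_cancel₀ hP.ne'] at this
      have e : (1 + t) ^ q = (1 + t) ^ (q - 1) * (1 + t) := by
        rw [Real.rpow_sub_one hpos.ne', div_mul_cancel₀ _ hpos.ne']
      have e2 : (1 + t) ^ q * (1 + q * ((1 + t)⁻¹ - 1))
          = (1 + t) ^ q - q * t * (1 + t) ^ (q - 1) := by
        rw [e]; field_simp; ring
      linarith
  -- The exponent `q - 1` may be below `1`, where Bernoulli fails; so `(1 + t) ^ (q - 1)` is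
  -- compared with `(1 + t) ^ q`, in the direction given by the sign of `t`.
  have key : t * ((1 + t) ^ (q - 1) - 1) ≤ q * 4 ^ q * t ^ 2 := by
    rcases le_total 0 t with ht | ht
    · have a1 : (1 + t) ^ (q - 1) ≤ (1 + t) ^ q :=
        Real.rpow_le_rpow_of_exponent_le (by linarith) (by linarith)
      have a2 : (1 + t) ^ (q - 1) ≤ 4 ^ q :=
        a1.trans (Real.rpow_le_rpow hu (by linarith) (by linarith))
      have a3 : q * t * (1 + t) ^ (q - 1) ≤ q * t * 4 ^ q := by gcongr
      nlinarith [mul_le_mul_of_nonneg_left (a1.trans (tangent.trans (by linarith :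
        _ ≤ 1 + q * t * 4 ^ q))) ht]
    · have a1 : (1 + t) ^ q ≤ (1 + t) ^ (q - 1) := by
        rcases hu.eq_or_lt with h0 | hpos
        · rw [← h0, Real.zero_rpow (by linarith)]; positivity
        · exact Real.rpow_le_rpow_of_exponent_ge hpos (by linarith) (by linarith)
      have a2 := one_add_mul_self_le_rpow_one_add h1 hq
      have a3 : t * ((1 + t) ^ (q - 1) - 1) ≤ t * (q * t) :=
        mul_le_mul_of_nonpos_left (by linarith) ht
      have : q * t ^ 2 * 1 ≤ q * t ^ 2 * 4 ^ q := by gcongr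
      nlinarith
  nlinarith [mul_le_mul_of_nonneg_left key (by linarith : 0 ≤ q)]

/-- Second-order expansion of `‖·‖ ^ p` in an inner product space, for `p ≥ 2`. -/
lemma norm_add_rpow_le {E : Type*} [NormedAddCommGroup E] [InnerProductSpace ℝ E]
    {p : ℝ} (hp : 2 ≤ p) : ∃ C : ℝ, 1 ≤ C ∧ ∀ s z : E,
      ‖s + z‖ ^ p ≤ ‖s‖ ^ p + p * inner ℝ (‖s‖ ^ (p - 2) • s) z
        + C * (‖s‖ ^ (p - 2) * ‖z‖ ^ (2 : ℝ) + ‖z‖ ^ p) := by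
  have h2p : (1 : ℝ) ≤ 2 ^ p := Real.one_le_rpow (by norm_num) (by linarith)
  -- `2 ^ p + p` serves the case `‖s‖ < ‖z‖`, where crude bounds suffice; the rest serves `‖z‖ ≤
  -- ‖s‖`, where the scalar expansion applies with exponent `p / 2`.
  refine ⟨2 ^ p + p + (p / 2 + 9 * ((p / 2) ^ 2 * 4 ^ (p / 2))), ?_, fun s z => ?_⟩
  · have : (0 : ℝ) ≤ (p / 2 + 9 * ((p / 2) ^ 2 * 4 ^ (p / 2))) := by positivity
    linarith
  set D := p / 2 + 9 * ((p / 2) ^ 2 * 4 ^ (p / 2)) with hD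
  have hD0 : 0 ≤ D := by positivity
  have hs := norm_nonneg s
  have hz := norm_nonneg z
  have hin := abs_le.1 (abs_real_inner_le_norm s z)
  rw [inner_smul_left, RCLike.conj_to_real]
  have A0 : 0 ≤ ‖s‖ ^ (p - 2) := by positivity
  have Z0 : 0 ≤ ‖z‖ ^ p := by positivity
  have AZ0 : 0 ≤ ‖s‖ ^ (p - 2) * ‖z‖ ^ (2 : ℝ) := by positivity
  rcases lt_or_ge ‖s‖ ‖z‖ with hlt | hle
  · have b1 : ‖s + z‖ ^ p ≤ 2 ^ p * ‖z‖ ^ p := by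
      rw [← Real.mul_rpow (by norm_num) hz]
      refine Real.rpow_le_rpow (norm_nonneg _) ?_ (by linarith)
      linarith [norm_add_le s z]
    have b2 : ‖s‖ ^ (p - 2) * (‖s‖ * ‖z‖) ≤ ‖z‖ ^ p := by
      have : ‖z‖ ^ p = ‖z‖ ^ (p - 2) * (‖z‖ * ‖z‖) := by
        have hz' : 0 < ‖z‖ := hs.trans_lt hlt
        rw [← pow_two, ← Real.rpow_natCast, ← Real.rpow_add hz']; norm_num
      rw [this]
      have : ‖s‖ ^ (p - 2) ≤ ‖z‖ ^ (p - 2) := Real.rpow_le_rpow hs hlt.le (by linarith)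
      gcongr
    have b3 : -(‖z‖ ^ p) ≤ ‖s‖ ^ (p - 2) * inner ℝ s z := by
      nlinarith [mul_le_mul_of_nonneg_left hin.1 A0]
    have b4 : 0 ≤ ‖s‖ ^ p := by positivity
    nlinarith [mul_le_mul_of_nonneg_left b3 (by linarith : 0 ≤ p), mul_nonneg hD0 Z0,
      mul_nonneg hD0 AZ0, mul_nonneg (by linarith : 0 ≤ p) AZ0, mul_nonneg (by linarith : (0:ℝ) ≤ 2 ^ p) AZ0]
  · rcases hs.eq_or_lt with h0 | hpos
    · have s0 : s = 0 := norm_eq_zero.1 h0.symm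
      have z0 : z = 0 := norm_eq_zero.1 (le_antisymm (h0 ▸ hle) hz)
      have : (0 : ℝ) ^ p = 0 := Real.zero_rpow (by linarith)
      subst s0 z0; simp [this]
    · have c2 : ‖s + z‖ ^ 2 = ‖s‖ ^ 2 + 2 * inner ℝ s z + ‖z‖ ^ 2 := norm_add_sq_real s z
      set t := (2 * inner ℝ s z + ‖z‖ ^ 2) / ‖s‖ ^ 2 with ht
      have hss : 0 < ‖s‖ ^ 2 := by positivity
      have c3 : ‖s‖ ^ 2 * t = 2 * inner ℝ s z + ‖z‖ ^ 2 := by rw [ht]; field_simp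
      have c4 : ‖s + z‖ ^ 2 = ‖s‖ ^ 2 * (1 + t) := by rw [c2, mul_add, c3]; ring
      have pw : ∀ v : ℝ, 0 ≤ v → v ^ p = (v ^ 2) ^ (p / 2) := fun v hv => by
        rw [← Real.rpow_natCast, ← Real.rpow_mul hv]; congr 1; push_cast; ring
      have u0 : 0 ≤ 1 + t := by
        by_contra! h
        nlinarith [sq_nonneg ‖s + z‖, mul_neg_of_pos_of_neg hss h]
      have t3 : t ≤ 3 := by
        rw [ht, div_le_iff₀ hss]; nlinarith
      have d1 := one_add_rpow_le_quadratic (q := p / 2) (by linarith) (by linarith) t3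
      have sp : ‖s‖ ^ p = ‖s‖ ^ (p - 2) * ‖s‖ ^ 2 := by
        rw [← Real.rpow_natCast, ← Real.rpow_add hpos]; norm_num
      have d2 : ‖s + z‖ ^ p = ‖s‖ ^ p * (1 + t) ^ (p / 2) := by
        rw [pw _ (norm_nonneg _), c4, Real.mul_rpow hss.le u0, ← pw _ hs]
      have d3 : ‖s‖ ^ 2 * t ^ 2 ≤ 9 * ‖z‖ ^ 2 := by
        have : |‖s‖ ^ 2 * t| ≤ ‖s‖ * (3 * ‖z‖) := by
          rw [c3, abs_le]; constructor <;> nlinarith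
        have e : ‖s‖ * (‖s‖ * |t|) ≤ ‖s‖ * (3 * ‖z‖) := by
          rw [abs_mul, abs_of_pos hss] at this; linarith
        have e' := le_of_mul_le_mul_left e hpos
        have := pow_le_pow_left₀ (by positivity) e' 2
        rw [mul_pow, sq_abs] at this; linarith
      have hz2 : ‖z‖ ^ (2 : ℝ) = ‖z‖ ^ 2 := by norm_cast
      have d4 : ‖s‖ ^ p * (1 + t) ^ (p / 2) ≤ ‖s‖ ^ (p - 2) * (‖s‖ ^ 2
          + p / 2 * (2 * inner ℝ s z + ‖z‖ ^ 2)
          + (p / 2) ^ 2 * 4 ^ (p / 2) * (9 * ‖z‖ ^ 2)) := by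
        rw [sp, mul_assoc]
        refine mul_le_mul_of_nonneg_left ?_ A0
        have f1 := mul_le_mul_of_nonneg_left d1 hss.le
        have f2 := mul_le_mul_of_nonneg_left d3
          (by positivity : 0 ≤ (p / 2) ^ 2 * (4 : ℝ) ^ (p / 2))
        rw [← c3]
        linarith
      have d5 : ‖s‖ ^ (p - 2) * (‖s‖ ^ 2 + p / 2 * (2 * inner ℝ s z + ‖z‖ ^ 2)
          + (p / 2) ^ 2 * 4 ^ (p / 2) * (9 * ‖z‖ ^ 2))
          = ‖s‖ ^ p + p * (‖s‖ ^ (p - 2) * inner ℝ s z)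
            + D * (‖s‖ ^ (p - 2) * ‖z‖ ^ (2 : ℝ)) := by
        rw [sp, hz2, hD]; ring
      rw [d2]
      have : 0 ≤ (2 ^ p + p) * (‖s‖ ^ (p - 2) * ‖z‖ ^ (2 : ℝ)) + (2 ^ p + p + D) * ‖z‖ ^ p := by
        positivity
      linarith

/-! ### Moments of sums of independent centred vectors. -/

section Moments

variable {Ω E : Type*} [MeasurableSpace Ω] {P : Measure Ω} [NormedAddCommGroup E]

lemma MeasureTheory.MemLp.integrable_norm_rpow_of_le [IsFiniteMeasure P] {X : Ω → E} {p a : ℝ}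
    (hX : MemLp X (ENNReal.ofReal p) P) (ha : 0 ≤ a) (hap : a ≤ p) :
    Integrable (fun ω => ‖X ω‖ ^ a) P := by
  have h := (hX.mono_exponent (ENNReal.ofReal_le_ofReal hap)).integrable_norm_rpow'
  rwa [ENNReal.toReal_ofReal ha] at h

/-- Splitting at `‖X‖ = σ` gives two contributions of at most `σ ^ a` each. -/
lemma MeasureTheory.MemLp.integral_norm_rpow_le [IsProbabilityMeasure P] {X : Ω → E} {p a σ : ℝ}
    (hX : MemLp X (ENNReal.ofReal p) P) (ha : 0 ≤ a) (hap : a ≤ p) (hσ : 0 < σ)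
    (hXσ : ∫ ω, ‖X ω‖ ^ p ∂P ≤ σ ^ p) :
    ∫ ω, ‖X ω‖ ^ a ∂P ≤ 2 * σ ^ a := by
  have hip := hX.integrable_norm_rpow_of_le (ha.trans hap) le_rfl
  have hpt : ∀ ω, ‖X ω‖ ^ a ≤ σ ^ (a - p) * ‖X ω‖ ^ p + σ ^ a := fun ω => by
    rcases le_total ‖X ω‖ σ with h | h
    · have := Real.rpow_le_rpow (norm_nonneg _) h ha
      have : 0 ≤ σ ^ (a - p) * ‖X ω‖ ^ p := by positivity
      linarith
    · have h0 : 0 < ‖X ω‖ := hσ.trans_le h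
      have e : ‖X ω‖ ^ a = ‖X ω‖ ^ (a - p) * ‖X ω‖ ^ p := by
        rw [← Real.rpow_add h0]; ring_nf
      have : ‖X ω‖ ^ (a - p) ≤ σ ^ (a - p) := Real.rpow_le_rpow_of_nonpos hσ h (by linarith)
      have : ‖X ω‖ ^ (a - p) * ‖X ω‖ ^ p ≤ σ ^ (a - p) * ‖X ω‖ ^ p := by gcongr
      have : 0 ≤ σ ^ a := by positivity
      linarith
  calc ∫ ω, ‖X ω‖ ^ a ∂P ≤ ∫ ω, (σ ^ (a - p) * ‖X ω‖ ^ p + σ ^ a) ∂P :=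
        integral_mono (hX.integrable_norm_rpow_of_le ha hap)
          ((hip.const_mul _).add (integrable_const _)) hpt
    _ = σ ^ (a - p) * ∫ ω, ‖X ω‖ ^ p ∂P + σ ^ a := by
        rw [integral_add (hip.const_mul _) (integrable_const _), integral_const_mul]; simp
    _ ≤ σ ^ (a - p) * σ ^ p + σ ^ a := by gcongr
    _ = 2 * σ ^ a := by rw [← Real.rpow_add hσ]; ring_nf

variable [InnerProductSpace ℝ E] [CompleteSpace E] [SecondCountableTopology E]
  [MeasurableSpace E] [BorelSpace E] [IsProbabilityMeasure P]

/-- Adding an independent centred variable raises the `p`-th moment only to second order. -/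
lemma ProbabilityTheory.IndepFun.integral_norm_add_rpow_le {p C : ℝ} (hp : 2 ≤ p)
    (hC : ∀ s z : E, ‖s + z‖ ^ p ≤ ‖s‖ ^ p + p * inner ℝ (‖s‖ ^ (p - 2) • s) z
        + C * (‖s‖ ^ (p - 2) * ‖z‖ ^ (2 : ℝ) + ‖z‖ ^ p))
    {X Z : Ω → E} (hXZ : IndepFun X Z P) (hX : MemLp X (ENNReal.ofReal p) P)
    (hZ : MemLp Z (ENNReal.ofReal p) P) (hZ0 : ∫ ω, Z ω ∂P = 0) :
    ∫ ω, ‖X ω + Z ω‖ ^ p ∂P ≤ ∫ ω, ‖X ω‖ ^ p ∂P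
      + C * ((∫ ω, ‖X ω‖ ^ (p - 2) ∂P) * (∫ ω, ‖Z ω‖ ^ (2 : ℝ) ∂P) + ∫ ω, ‖Z ω‖ ^ p ∂P) := by
  have h1p : (1 : ℝ≥0∞) ≤ ENNReal.ofReal p := ENNReal.one_le_ofReal.2 (by linarith)
  have mφ : Measurable fun s : E => ‖s‖ ^ (p - 2) • s :=
    (measurable_norm.pow_const _).smul measurable_id
  have mn : ∀ a : ℝ, Measurable fun s : E => ‖s‖ ^ a := fun a => measurable_norm.pow_const a
  have iX := hX.integrable_norm_rpow_of_le (by linarith) le_rfl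
  have iZ := hZ.integrable_norm_rpow_of_le (by linarith) le_rfl
  have iX2 := hX.integrable_norm_rpow_of_le (a := p - 2) (by linarith) (by linarith)
  have iZ2 := hZ.integrable_norm_rpow_of_le (a := 2) (by norm_num) hp
  have iφ : Integrable (fun ω => ‖X ω‖ ^ (p - 2) • X ω) P := by
    refine (hX.integrable_norm_rpow_of_le (a := p - 1) (by linarith) (by linarith)).mono
      (mφ.comp_aemeasurable hX.1.aemeasurable).aestronglyMeasurable (ae_of_all _ fun ω => ?_)
    rw [norm_smul, Real.norm_of_nonneg (by positivity), Real.norm_of_nonneg (by positivity)]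
    rcases (norm_nonneg (X ω)).eq_or_lt with h | h
    · rw [← h, mul_zero]; positivity
    · nth_rw 2 [← Real.rpow_one ‖X ω‖]
      rw [← Real.rpow_add h]; ring_nf; rfl
  have ind1 : IndepFun (fun ω => ‖X ω‖ ^ (p - 2) • X ω) Z P := hXZ.comp mφ measurable_id
  have ind2 : IndepFun (fun ω => ‖X ω‖ ^ (p - 2)) (fun ω => ‖Z ω‖ ^ (2 : ℝ)) P :=
    hXZ.comp (mn _) (mn _)
  have iin : Integrable (fun ω => inner ℝ (‖X ω‖ ^ (p - 2) • X ω) (Z ω)) P :=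
    ind1.integrable_bilin iφ (hZ.integrable h1p) (innerSL ℝ)
  -- Independence factors the expectation of the bilinear form, and `Z` has mean zero.
  have zin : ∫ ω, inner ℝ (‖X ω‖ ^ (p - 2) • X ω) (Z ω) ∂P = 0 := by
    have := ind1.integral_bilin iφ (hZ.integrable h1p) (innerSL ℝ)
    rw [hZ0, map_zero] at this
    exact this
  have imul : Integrable (fun ω => ‖X ω‖ ^ (p - 2) * ‖Z ω‖ ^ (2 : ℝ)) P :=
    ind2.integrable_mul iX2 iZ2
  have vmul := ind2.integral_fun_mul_eq_mul_integral iX2.1 iZ2.1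
  have i1 := iX.add (iin.const_mul p)
  have i2 := (imul.add iZ).const_mul C
  calc ∫ ω, ‖X ω + Z ω‖ ^ p ∂P
      ≤ ∫ ω, ((‖X ω‖ ^ p + p * inner ℝ (‖X ω‖ ^ (p - 2) • X ω) (Z ω))
        + C * (‖X ω‖ ^ (p - 2) * ‖Z ω‖ ^ (2 : ℝ) + ‖Z ω‖ ^ p)) ∂P :=
        integral_mono ((hX.add hZ).integrable_norm_rpow_of_le (by linarith) le_rfl)
          (i1.add i2) fun ω => hC _ _
    _ = _ := by
        rw [integral_add (by exact i1) (by exact i2), integral_add iX (iin.const_mul p),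
          integral_const_mul, zin, integral_const_mul, integral_add imul iZ, vmul]
        ring

/-- Marcinkiewicz–Zygmund inequality for centred independent variables in a Hilbert space. -/
theorem exists_integral_norm_sum_rpow_le (E : Type*) [NormedAddCommGroup E]
    [InnerProductSpace ℝ E] [CompleteSpace E] [SecondCountableTopology E]
    [MeasurableSpace E] [BorelSpace E] {p : ℝ} (hp : 2 ≤ p) :
    ∃ K : ℝ, 0 < K ∧ ∀ (Ω : Type*) (_ : MeasurableSpace Ω) (P : Measure Ω)
      (_ : IsProbabilityMeasure P) (Z : ℕ → Ω → E) (τ : ℝ), 0 < τ → iIndepFun Z P →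
      (∀ j, MemLp (Z j) (ENNReal.ofReal p) P) → (∀ j, ∫ ω, Z j ω ∂P = 0) →
      (∀ j, ∫ ω, ‖Z j ω‖ ^ p ∂P ≤ τ ^ p) → ∀ n : ℕ, 1 ≤ n →
      ∫ ω, ‖∑ j ∈ Finset.range n, Z j ω‖ ^ p ∂P ≤ (K * n) ^ (p / 2) * τ ^ p := by
  obtain ⟨C, hC1, hC⟩ := norm_add_rpow_le (E := E) hp
  -- `5 = 2 * 2 + 1`: two moment comparisons, each costing a factor `2`, plus the term `‖Z n‖ ^ p`.
  refine ⟨5 * C, by linarith, fun Ω _ P _ Z τ hτ hind hZ hZ0 hZτ n hn => ?_⟩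
  have hτp : 0 < τ ^ p := by positivity
  induction n, hn using Nat.le_induction with
  | base =>
    have : (1 : ℝ) ≤ (5 * C * (1 : ℕ)) ^ (p / 2) :=
      Real.one_le_rpow (by push_cast; linarith) (by linarith)
    simp only [Finset.range_one, Finset.sum_singleton]
    nlinarith [hZτ 0]
  | succ n hn ih =>
    have hS : MemLp (fun ω => ∑ j ∈ Finset.range n, Z j ω) (ENNReal.ofReal p) P :=
      memLp_finsetSum _ fun j _ => hZ j
    have hi : IndepFun (fun ω => ∑ j ∈ Finset.range n, Z j ω) (Z n) P := by
      have := hind.indepFun_finsetSum_of_notMem₀ (fun j => (hZ j).1.aemeasurable)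
        (Finset.notMem_range_self (n := n))
      convert! this using 1
      ext ω; simp
    have step := hi.integral_norm_add_rpow_le hp hC hS (hZ n) (hZ0 n)
    have hn1 : (1 : ℝ) ≤ n := by exact_mod_cast hn
    set A : ℝ := 5 * C * n with hA
    have hA1 : 1 ≤ A := by nlinarith
    have hA0 : 0 < A := by linarith
    -- The induction hypothesis says that the partial sum has `p`-th moment at most `σ ^ p` with `σ
    -- = A^{1/2} τ`, which then controls its moment of order `p - 2`.
    have pw : ∀ a : ℝ, (A ^ (1 / 2 : ℝ) * τ) ^ a = A ^ (a / 2) * τ ^ a := fun a => by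
      rw [Real.mul_rpow (by positivity) hτ.le, ← Real.rpow_mul hA0.le]; ring_nf
    have m1 := hS.integral_norm_rpow_le (a := p - 2) (by linarith) (by linarith)
      (σ := A ^ (1 / 2 : ℝ) * τ) (by positivity) (by rw [pw]; exact ih)
    have m2 := (hZ n).integral_norm_rpow_le (a := 2) (by norm_num) hp hτ (hZτ n)
    rw [pw] at m1
    have m3 : (∫ ω, ‖∑ j ∈ Finset.range n, Z j ω‖ ^ (p - 2) ∂P) * (∫ ω, ‖Z n ω‖ ^ (2 : ℝ) ∂P)
        ≤ 4 * A ^ (p / 2 - 1) * τ ^ p := by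
      calc _ ≤ (2 * (A ^ ((p - 2) / 2) * τ ^ (p - 2))) * (2 * τ ^ (2 : ℝ)) := by gcongr
        _ = 4 * A ^ ((p - 2) / 2) * (τ ^ (p - 2) * τ ^ (2 : ℝ)) := by ring
        _ = _ := by rw [← Real.rpow_add hτ]; ring_nf
    have hA' : (1 : ℝ) ≤ A ^ (p / 2 - 1) := Real.one_le_rpow hA1 (by linarith)
    have hB0 : 0 < A + 5 * C := by linarith
    have fin : A ^ (p / 2) + 5 * C * A ^ (p / 2 - 1) ≤ (A + 5 * C) ^ (p / 2) := by
      have e : ∀ u : ℝ, 0 < u → u ^ (p / 2) = u ^ (p / 2 - 1) * u := fun u hu => by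
        rw [Real.rpow_sub_one hu.ne', div_mul_cancel₀ _ hu.ne']
      rw [e _ hA0, e _ hB0]
      have : A ^ (p / 2 - 1) ≤ (A + 5 * C) ^ (p / 2 - 1) :=
        Real.rpow_le_rpow hA0.le (by linarith) (by linarith)
      calc _ = A ^ (p / 2 - 1) * (A + 5 * C) := by ring
        _ ≤ _ := by gcongr
    have hcast : 5 * C * ((n + 1 : ℕ) : ℝ) = A + 5 * C := by push_cast; ring
    simp only [Finset.sum_range_succ]
    rw [hcast]
    calc _ ≤ A ^ (p / 2) * τ ^ p + C * (4 * A ^ (p / 2 - 1) * τ ^ p + τ ^ p) := by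
          refine step.trans (add_le_add ih (mul_le_mul_of_nonneg_left
            (add_le_add m3 (hZτ n)) (by linarith)))
      _ ≤ A ^ (p / 2) * τ ^ p + C * (4 * A ^ (p / 2 - 1) * τ ^ p + A ^ (p / 2 - 1) * τ ^ p) := by
          have : τ ^ p ≤ A ^ (p / 2 - 1) * τ ^ p := le_mul_of_one_le_left hτp.le hA'
          gcongr
      _ = (A ^ (p / 2) + 5 * C * A ^ (p / 2 - 1)) * τ ^ p := by ring
      _ ≤ _ := by gcongr

end Moments

/-! ### Weights and weighted means. -/

namespace MinMaxCBO

variable {d₁ d₂ : ℕ} {ℰ : EuclideanSpace ℝ (Fin d₁) → EuclideanSpace ℝ (Fin d₂) → ℝ}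

/-- The Lipschitz bound serves only to make the weights continuous, hence measurable, in `y`; so `L`
and `s` never enter the constant. -/
lemma PolyLipschitzCost.continuous_right (hL : PolyLipschitzCost ℰ)
    (x : EuclideanSpace ℝ (Fin d₁)) : Continuous (ℰ x) := by
  obtain ⟨L, hL0, s, hs, h⟩ := hL
  let z : EuclideanSpace ℝ (Fin d₂) → WithLp 2 (EuclideanSpace ℝ (Fin d₁) × EuclideanSpace ℝ (Fin d₂)) :=
    fun y => WithLp.toLp 2 (x, y)
  have hz : Continuous z := by fun_prop
  refine continuous_iff_continuousAt.2 fun y₀ => ?_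
  rw [ContinuousAt, tendsto_iff_norm_sub_tendsto_zero]
  refine squeeze_zero (fun _ => norm_nonneg _) (fun y => h (z y) (z y₀)) ?_
  have hc : Continuous fun y => L * (1 + ‖z y‖ + ‖z y₀‖) ^ s * ‖z y - z y₀‖ := by
    refine (continuous_const.mul (Continuous.rpow_const (by fun_prop) fun _ => Or.inr hs)).mul
      (by fun_prop)
  have := hc.tendsto y₀
  simpa using this

lemma PolyLipschitzCost.continuous_weight (hL : PolyLipschitzCost ℰ) (γ : ℝ)
    (x : EuclideanSpace ℝ (Fin d₁)) : Continuous (weight ℰ γ x) :=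
  Real.continuous_exp.comp (continuous_const.mul (hL.continuous_right x))

lemma BoundedCost.abs_exponent_le {c : ℝ} (hb : BoundedCost ℰ c) (γ : ℝ)
    (x : EuclideanSpace ℝ (Fin d₁)) (y : EuclideanSpace ℝ (Fin d₂)) :
    |-γ * ℰ x y| ≤ |γ| * c := by
  rw [abs_mul, abs_neg]
  exact mul_le_mul_of_nonneg_left (abs_le.2 (hb x y)) (abs_nonneg _)

lemma BoundedCost.le_weight {c : ℝ} (hb : BoundedCost ℰ c) (γ : ℝ)
    (x : EuclideanSpace ℝ (Fin d₁)) (y : EuclideanSpace ℝ (Fin d₂)) :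
    Real.exp (-(|γ| * c)) ≤ weight ℰ γ x y :=
  Real.exp_le_exp.2 (abs_le.1 (hb.abs_exponent_le γ x y)).1

lemma BoundedCost.weight_le {c : ℝ} (hb : BoundedCost ℰ c) (γ : ℝ)
    (x : EuclideanSpace ℝ (Fin d₁)) (y : EuclideanSpace ℝ (Fin d₂)) :
    weight ℰ γ x y ≤ Real.exp (|γ| * c) :=
  Real.exp_le_exp.2 (abs_le.1 (hb.abs_exponent_le γ x y)).2

lemma BoundedCost.norm_weight_le {c : ℝ} (hb : BoundedCost ℰ c) (γ : ℝ)
    (x : EuclideanSpace ℝ (Fin d₁)) (y : EuclideanSpace ℝ (Fin d₂)) :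
    ‖weight ℰ γ x y‖ ≤ Real.exp (|γ| * c) := by
  rw [weight, Real.norm_of_nonneg (Real.exp_pos _).le]
  exact hb.weight_le γ x y

lemma integral_empiricalMeasure {d : ℕ} {F : Type*} [NormedAddCommGroup F] [NormedSpace ℝ F]
    [CompleteSpace F] (N : ℕ) (v : ℕ → EuclideanSpace ℝ (Fin d))
    (f : EuclideanSpace ℝ (Fin d) → F) :
    ∫ y, f y ∂empiricalMeasure N v = (N : ℝ)⁻¹ • ∑ j ∈ Finset.range N, f (v j) := by
  rw [empiricalMeasure, integral_smul_measure, integral_finsetSum_measure]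
  · simp
  · intro j _; exact integrable_dirac (by finiteness)

/-- Moving `m` inside the numerator makes the error an exact ratio of sums, with centred summands
once `m` is the true weighted mean. -/
lemma consensusY_empiricalMeasure_sub (β : ℝ) {N : ℕ} (hN : 1 ≤ N)
    (v : ℕ → EuclideanSpace ℝ (Fin d₂)) (x : EuclideanSpace ℝ (Fin d₁))
    (m : EuclideanSpace ℝ (Fin d₂)) :
    consensusY ℰ β (empiricalMeasure N v) x - m
      = (∑ j ∈ Finset.range N, weight ℰ (-β) x (v j))⁻¹ •
        ∑ j ∈ Finset.range N, weight ℰ (-β) x (v j) • (v j - m) := by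
  have hN0 : (N : ℝ) ≠ 0 := by positivity
  have hW : (∑ j ∈ Finset.range N, weight ℰ (-β) x (v j)) ≠ 0 :=
    (Finset.sum_pos (fun j _ => Real.exp_pos _) (Finset.nonempty_range_iff.2 (by omega))).ne'
  rw [consensusY, integral_empiricalMeasure, integral_empiricalMeasure, smul_eq_mul, mul_inv,
    inv_inv, smul_smul, mul_right_comm, mul_inv_cancel₀ hN0, one_mul]
  simp_rw [smul_sub]
  rw [Finset.sum_sub_distrib, ← Finset.sum_smul, smul_sub, inv_smul_smul₀ hW]

lemma finiteMomentMeasures.memLp_id {d : ℕ} {r p : ℝ} {μ : Measure (EuclideanSpace ℝ (Fin d))}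
    (hμ : μ ∈ finiteMomentMeasures d r) (hp : 0 < p) (hpr : p ≤ r) :
    MemLp id (ENNReal.ofReal p) μ := by
  have := hμ.1
  have hr : 0 < r := hp.trans_le hpr
  refine MemLp.mono_exponent (q := ENNReal.ofReal r) ⟨aestronglyMeasurable_id, ?_⟩
    (ENNReal.ofReal_le_ofReal hpr)
  refine (eLpNorm_lt_top_iff_lintegral_rpow_enorm_lt_top (by simpa using hr)
    ENNReal.ofReal_ne_top).2 ?_
  rw [ENNReal.toReal_ofReal hr.le]
  exact hμ.2

lemma integrable_weight_smul {c : ℝ} {μ : Measure (EuclideanSpace ℝ (Fin d₂))}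
    (hb : BoundedCost ℰ c) (hL : PolyLipschitzCost ℰ)
    (γ : ℝ) (hμ1 : Integrable id μ) (x : EuclideanSpace ℝ (Fin d₁)) :
    Integrable (fun y => weight ℰ γ x y • y) μ :=
  hμ1.bdd_smul (Real.exp (|γ| * c)) (hL.continuous_weight γ x).aestronglyMeasurable
    (ae_of_all _ (hb.norm_weight_le γ x))

section Centring

variable {c : ℝ} {μ : Measure (EuclideanSpace ℝ (Fin d₂))} [IsProbabilityMeasure μ]

lemma integrable_weight (hb : BoundedCost ℰ c) (hL : PolyLipschitzCost ℰ) (γ : ℝ)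
    (x : EuclideanSpace ℝ (Fin d₁)) : Integrable (weight ℰ γ x) μ :=
  Integrable.of_bound (hL.continuous_weight γ x).aestronglyMeasurable (Real.exp (|γ| * c))
    (ae_of_all _ (hb.norm_weight_le γ x))

lemma le_integral_weight (hb : BoundedCost ℰ c) (hL : PolyLipschitzCost ℰ) (γ : ℝ)
    (x : EuclideanSpace ℝ (Fin d₁)) : Real.exp (-(|γ| * c)) ≤ ∫ y, weight ℰ γ x y ∂μ := by
  have := integral_mono (integrable_const (Real.exp (-(|γ| * c))))
    (integrable_weight (μ := μ) hb hL γ x) (hb.le_weight γ x)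
  simpa using this

lemma integral_weight_smul_sub_consensusY (hb : BoundedCost ℰ c) (hL : PolyLipschitzCost ℰ)
    (β : ℝ) (hμ1 : Integrable id μ) (x : EuclideanSpace ℝ (Fin d₁)) :
    ∫ y, weight ℰ (-β) x y • (y - consensusY ℰ β μ x) ∂μ = 0 := by
  have hW : (∫ y, weight ℰ (-β) x y ∂μ) ≠ 0 :=
    ((Real.exp_pos _).trans_le (le_integral_weight hb hL (-β) x)).ne'
  simp_rw [smul_sub]
  rw [integral_sub (integrable_weight_smul hb hL _ hμ1 x)
    ((integrable_weight hb hL _ x).smul_const _), integral_smul_const, consensusY,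
    smul_inv_smul₀ hW, sub_self]

/-- The bound involves neither `x` nor `ℰ`, so the final constant can be fixed before either is
given. -/
lemma norm_consensusY_le (hb : BoundedCost ℰ c) (hL : PolyLipschitzCost ℰ)
    (β : ℝ) (hμ1 : Integrable id μ) (x : EuclideanSpace ℝ (Fin d₁)) :
    ‖consensusY ℰ β μ x‖
      ≤ (Real.exp (-(|β| * c)))⁻¹ * (Real.exp (|β| * c) * ∫ y, ‖y‖ ∂μ) := by
  have h1 := le_integral_weight (μ := μ) hb hL (-β) x
  rw [abs_neg] at h1
  have h2 : ‖∫ y, weight ℰ (-β) x y • y ∂μ‖ ≤ Real.exp (|β| * c) * ∫ y, ‖y‖ ∂μ := by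
    rw [← integral_const_mul]
    refine norm_integral_le_of_norm_le (hμ1.norm.const_mul _) (ae_of_all _ fun y => ?_)
    rw [norm_smul]
    have := hb.norm_weight_le (-β) x y
    rw [abs_neg] at this
    exact mul_le_mul_of_nonneg_right this (norm_nonneg _)
  rw [consensusY, norm_smul, norm_inv,
    Real.norm_of_nonneg ((Real.exp_pos _).le.trans h1)]
  gcongr

end Centring

end MinMaxCBO

/-! ### The convergence rate. -/

/-- Integrability is part of the conclusion because the Bochner integral of a non-integrable
function is `0`, which would make the bound void. -/
theorem lemma2p7 (d₁ d₂ : ℕ) (β c : ℝ) (hc : 0 < c) (p r : ℝ) (hp : 2 ≤ p) (hpr : p < r)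
    (μ : Measure (EuclideanSpace ℝ (Fin d₂))) (hμ : μ ∈ MinMaxCBO.finiteMomentMeasures d₂ r) :
    ∃ C : ℝ, 0 < C ∧
      ∀ ℰ : EuclideanSpace ℝ (Fin d₁) → EuclideanSpace ℝ (Fin d₂) → ℝ,
        MinMaxCBO.BoundedCost ℰ c → MinMaxCBO.PolyLipschitzCost ℰ →
      ∀ (Ω : Type*) (_ : MeasurableSpace Ω) (P : Measure Ω) (_ : IsProbabilityMeasure P)
        (Y : ℕ → Ω → EuclideanSpace ℝ (Fin d₂)),
        (∀ j, HasLaw (Y j) μ P) → iIndepFun Y P →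
      ∀ N : ℕ, 1 ≤ N → ∀ x : EuclideanSpace ℝ (Fin d₁),
        Integrable (fun ω => ‖MinMaxCBO.consensusY ℰ β
          (MinMaxCBO.empiricalMeasure N (fun j => Y j ω)) x
            - MinMaxCBO.consensusY ℰ β μ x‖ ^ p) P ∧
        ∫ ω, ‖MinMaxCBO.consensusY ℰ β
          (MinMaxCBO.empiricalMeasure N (fun j => Y j ω)) x
            - MinMaxCBO.consensusY ℰ β μ x‖ ^ p ∂P ≤ C * (N : ℝ) ^ (-(p / 2)) := by
  have hμP := hμ.1
  obtain ⟨K, hK, hMZ⟩ := exists_integral_norm_sum_rpow_le (EuclideanSpace ℝ (Fin d₂)) hp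
  have hp0 : 0 < p := by linarith
  have hLp := MinMaxCBO.finiteMomentMeasures.memLp_id hμ hp0 hpr.le
  have hμ1 : Integrable id μ := hLp.integrable (ENNReal.one_le_ofReal.2 (by linarith))
  set a := Real.exp (-(|β| * c)) with ha
  set b := Real.exp (|β| * c) with hb
  have ha0 : 0 < a := Real.exp_pos _
  have hb0 : 0 < b := Real.exp_pos _
  set m₀ := a⁻¹ * (b * ∫ y, ‖y‖ ∂μ) with hm₀
  have hm0 : 0 ≤ m₀ := by positivity
  have hGLp : MemLp (fun y => b * (‖y‖ + m₀)) (ENNReal.ofReal p) μ :=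
    (hLp.norm.add (memLp_const m₀)).const_mul b
  set M := ∫ y, ‖b * (‖y‖ + m₀)‖ ^ p ∂μ with hM
  have hM0 : 0 ≤ M := by positivity
  -- The `+ 1` keeps `τ` positive even when `M = 0`.
  set τ := (M + 1) ^ (1 / p) with hτ
  have hτ0 : 0 < τ := by positivity
  have hτp : τ ^ p = M + 1 := by
    rw [hτ, ← Real.rpow_mul (by linarith), one_div_mul_cancel hp0.ne', Real.rpow_one]
  refine ⟨(a ^ p)⁻¹ * (K ^ (p / 2) * τ ^ p), by positivity, ?_⟩
  intro ℰ hbd hL Ω _ P _ Y hY hind N hN x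
  set m := MinMaxCBO.consensusY ℰ β μ x with hm
  have hmle : ‖m‖ ≤ m₀ := MinMaxCBO.norm_consensusY_le hbd hL β hμ1 x
  have hwc := hL.continuous_weight (-β) x
  have hwa : ∀ y, a ≤ MinMaxCBO.weight ℰ (-β) x y := fun y => by
    simpa only [abs_neg] using hbd.le_weight (-β) x y
  have hwb : ∀ y, MinMaxCBO.weight ℰ (-β) x y ≤ b := fun y => by
    simpa only [abs_neg] using hbd.weight_le (-β) x y
  set g : EuclideanSpace ℝ (Fin d₂) → EuclideanSpace ℝ (Fin d₂) :=
    fun y => MinMaxCBO.weight ℰ (-β) x y • (y - m) with hg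
  have hgc : Continuous g := hwc.smul (continuous_id.sub continuous_const)
  have hgle : ∀ y, ‖g y‖ ≤ ‖b * (‖y‖ + m₀)‖ := fun y => by
    rw [hg, norm_smul, Real.norm_of_nonneg (ha0.le.trans (hwa y)),
      Real.norm_of_nonneg (by positivity)]
    exact mul_le_mul (hwb y) ((norm_sub_le _ _).trans (by linarith)) (norm_nonneg _) hb0.le
  have hgLp : MemLp g (ENNReal.ofReal p) μ :=
    hGLp.mono hgc.aestronglyMeasurable (ae_of_all _ hgle)
  have hgM : ∫ y, ‖g y‖ ^ p ∂μ ≤ τ ^ p := by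
    rw [hτp]
    have : ∫ y, ‖g y‖ ^ p ∂μ ≤ M :=
      integral_mono (hgLp.integrable_norm_rpow_of_le hp0.le le_rfl)
        (hGLp.integrable_norm_rpow_of_le hp0.le le_rfl)
        fun y => Real.rpow_le_rpow (norm_nonneg _) (hgle y) hp0.le
    linarith
  have hZLp : ∀ j, MemLp (g ∘ Y j) (ENNReal.ofReal p) P := fun j =>
    MemLp.comp_of_map ((hY j).map_eq ▸ hgLp) (hY j).aemeasurable
  have hsum := hMZ Ω _ P inferInstance (fun j => g ∘ Y j) τ hτ0
    (hind.comp (fun _ => g) fun _ => hgc.measurable) hZLp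
    (fun j => by
      rw [(hY j).integral_comp hgc.aestronglyMeasurable]
      exact MinMaxCBO.integral_weight_smul_sub_consensusY hbd hL β hμ1 x)
    (fun j => by
      refine le_of_eq_of_le ?_ hgM
      exact (hY j).integral_comp (f := fun y => ‖g y‖ ^ p)
        (hgLp.integrable_norm_rpow_of_le hp0.le le_rfl).1) N hN
  have hSi : Integrable (fun ω => ‖∑ j ∈ Finset.range N, (g ∘ Y j) ω‖ ^ p) P :=
    (memLp_finsetSum _ fun j _ => hZLp j).integrable_norm_rpow_of_le hp0.le le_rfl
  have hN0 : (0 : ℝ) < N := by exact_mod_cast hN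
  have hrepr : ∀ ω, MinMaxCBO.consensusY ℰ β (MinMaxCBO.empiricalMeasure N (fun j => Y j ω)) x - m
      = (∑ j ∈ Finset.range N, MinMaxCBO.weight ℰ (-β) x (Y j ω))⁻¹ •
        ∑ j ∈ Finset.range N, (g ∘ Y j) ω :=
    fun ω => MinMaxCBO.consensusY_empiricalMeasure_sub β hN _ x m
  -- The random denominator is replaced by its sure lower bound `N * a`.
  have hpt : ∀ ω, ‖MinMaxCBO.consensusY ℰ β
      (MinMaxCBO.empiricalMeasure N (fun j => Y j ω)) x - m‖ ^ p
      ≤ ((N * a) ^ p)⁻¹ * ‖∑ j ∈ Finset.range N, (g ∘ Y j) ω‖ ^ p := fun ω => by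
    have hden : N * a ≤ ∑ j ∈ Finset.range N, MinMaxCBO.weight ℰ (-β) x (Y j ω) := by
      have := Finset.card_nsmul_le_sum (Finset.range N)
        (fun j => MinMaxCBO.weight ℰ (-β) x (Y j ω)) a fun j _ => hwa _
      simpa using this
    have hNa : 0 < N * a := by positivity
    rw [hrepr, norm_smul, norm_inv, Real.norm_of_nonneg (hNa.le.trans hden),
      ← Real.inv_rpow hNa.le, ← Real.mul_rpow (by positivity) (norm_nonneg _)]
    refine Real.rpow_le_rpow (mul_nonneg (inv_nonneg.2 (hNa.le.trans hden)) (norm_nonneg _)) ?_ hp0.le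
    gcongr
  have hmeas : AEStronglyMeasurable (fun ω => ‖MinMaxCBO.consensusY ℰ β
      (MinMaxCBO.empiricalMeasure N (fun j => Y j ω)) x - m‖ ^ p) P := by
    simp_rw [hrepr]
    have h1 : AEMeasurable (fun ω => ∑ j ∈ Finset.range N, MinMaxCBO.weight ℰ (-β) x (Y j ω)) P :=
      Finset.aemeasurable_fun_sum _ fun j _ => hwc.measurable.comp_aemeasurable (hY j).aemeasurable
    have h2 : AEMeasurable (fun ω => ∑ j ∈ Finset.range N, (g ∘ Y j) ω) P :=
      Finset.aemeasurable_fun_sum _ fun j _ => (hZLp j).1.aemeasurable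
    exact ((h1.inv.smul h2).norm.pow_const p).aestronglyMeasurable
  have hint := Integrable.mono' (hSi.const_mul ((N * a) ^ p)⁻¹) hmeas (ae_of_all _ fun ω => by
    rw [Real.norm_of_nonneg (by positivity)]; exact hpt ω)
  refine ⟨hint, ?_⟩
  calc _ ≤ ∫ ω, ((N * a) ^ p)⁻¹ * ‖∑ j ∈ Finset.range N, (g ∘ Y j) ω‖ ^ p ∂P :=
        integral_mono hint (hSi.const_mul _) hpt
    _ = ((N * a) ^ p)⁻¹ * ∫ ω, ‖∑ j ∈ Finset.range N, (g ∘ Y j) ω‖ ^ p ∂P :=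
        integral_const_mul _ _
    _ ≤ ((N * a) ^ p)⁻¹ * ((K * N) ^ (p / 2) * τ ^ p) := by gcongr
    _ = (a ^ p)⁻¹ * (K ^ (p / 2) * τ ^ p) * ((N : ℝ) ^ (p / 2) * (N : ℝ) ^ (-p)) := by
        rw [Real.mul_rpow hN0.le ha0.le, Real.mul_rpow hK.le hN0.le, mul_inv,
          Real.rpow_neg hN0.le]
        ring
    _ = _ := by rw [← Real.rpow_add hN0]; ring_nf
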